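/- **Setting.** A seller has one unit of each of $m$ items and there are $n$ buyers. The buyers are additive: buyer $j$ values a bundle $q\in\mathbb Z_{\ge 0}^m$ at $\sum_i q[i]\,v_j(e_i)$, so the buyers' values are given by $v=(v_j(e_i))_{i,j}$; write $v(i)=(v_1(e_i),\dots,v_n(e_i))$. The cost function is additive, $c(q)=\sum_i q[i]\,c(e_i)$. The values are drawn from a probability distribution $D$, with support $\mathcal X$, that is item-independent: the vectors $v(1),\dots,v(m)$ are mutually independent (different buyers' values for the same item may be arbitrarily correlated). *Mechanisms.* There is a price (reserve) $p_j(e_i)\in\mathbb R$ per item $i$ and buyer $j$. - Item pricing: the buyers arrive in a fixed but arbitrary order, and each buys, at her prices, the utility-maximizing bundle of the remaining items (buying when indifferent). The profit is the sum of the payments minus the cost of the bundles sold. - Second-price item auction with reserves: for each item $i$, the highest bidder $j$ (ties broken by any fixed rule depending on the bids for that item) wins the item if $v_j(e_i)\ge p_j(e_i)$, and then pays the maximum of $p_j(e_i)$ and the second highest bid (just $p_j(e_i)$ if $n=1$); otherwise the item is unsold. The profit is the sum of the payments minus the cost of the bundles sold. *Classes.* Prices (reserves) are anonymous if $p_1(e_i)=\dots=p_n(e_i)$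 for every $i$. An anonymous class $\mathcal M$ consists of all mechanisms whose common price of item $i$ lies in $P_i$ for every $i$, where $P_1,\dots,P_m\subseteq\mathbb R$ are arbitrary sets; a non-anonymous class $\mathcal M'$ consists of all mechanisms with $(p_1(e_i),\dots,p_n(e_i))\in P_i$ for every $i$, where $P_1,\dots,P_m\subseteq\mathbb R^n$ are arbitrary sets. For a class $\mathcal M$ let $U=U(\mathcal M)=\sup_{M\in\mathcal M,\,v\in\mathcal X}|\mathrm{profit}_M(v)|$ (when profits are nonnegative, this is the maximum profit achievable by the class over the support), and for $S=(v^{(1)},\dots,v^{(N)})$, $N\ge 1$, let $$\widehat{\mathcal R}_S(\mathcal M)=\mathbb E_{\sigma}\Big[\sup_{M\in\mathcal M}\frac1N\sum_{k=1}^N\sigma_k\,\mathrm{profit}_M\big(v^{(k)}\big)\Big],$$ where $\sigma$ is uniform on $\{-1,1\}^N$. **Theorem.** There is an absolute constant $C>0$ such that, for all $m,n$, all $N\ge 1$, all $D$ and $c$ as above, and every sample $S\in\mathcal X^N$: 1. for every class $\mathcal M$ of item-pricing mechanisms with anonymous prices with $U(\mathcal M)<\infty$, $\ \widehat{\mathcal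 R}_S(\mathcal M)\le C\,U(\mathcal M)\sqrt{1/N}$; 2. if $n\ge 2$, for every class $\mathcal M'$ of item-pricing mechanisms with non-anonymous prices with $U(\mathcal M')<\infty$, $\ \widehat{\mathcal R}_S(\mathcal M')\le C\,U(\mathcal M')\sqrt{n\log n/N}$; 3. for every class $\mathcal M$ of second-price item auctions with anonymous reserves with $U(\mathcal M)<\infty$, $\ \widehat{\mathcal R}_S(\mathcal M)\le C\,U(\mathcal M)\sqrt{1/N}$; 4. if $n\ge 2$, for every class $\mathcal M'$ of second-price item auctions with non-anonymous reserves with $U(\mathcal M')<\infty$, $\ \widehat{\mathcal R}_S(\mathcal M')\le C\,U(\mathcal M')\sqrt{n\log n/N}$. -/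

import Mathlib

open MeasureTheory ProbabilityTheory

/-- A bundle of `m` goods: the number of units of each item. -/
abbrev Bundle (m : ℕ) : Type := Fin m → ℕ

/-- The buyers' values for the single items (or a matrix of prices): `v i j` is the value of buyer
`j` for one unit of item `i` (the price of item `i` for buyer `j`), so that `v i` is the vector of
all buyers' values for item `i`. -/
abbrev ItemMatrix (m n : ℕ) : Type := Fin m → Fin n → ℝ

/-- The bundle with one unit of each item in `B`. -/
def unitBundle {m : ℕ} (B : Finset (Fin m)) : Bundle m := fun i => if i ∈ B then 1 else 0

/-- The value of an additive buyer `j` for the bundle `q`. -/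
def additiveValue {m n : ℕ} (v : ItemMatrix m n) (j : Fin n) (q : Bundle m) : ℝ :=
  ∑ i, (q i : ℝ) * v i j

/-- The cost function is additive: `c(q) = ∑ i, q[i] * c(e_i)`. -/
def IsAdditiveCost {m : ℕ} (c : Bundle m → ℝ) : Prop :=
  ∀ q : Bundle m, c q = ∑ i, (q i : ℝ) * c (unitBundle {i})

/-- The distribution over the values of additive buyers is item-independent: the value vectors for
the different items are mutually independent. The values of different buyers for the same item may
be correlated. -/
def ItemIndependent {m n : ℕ} (D : Measure (ItemMatrix m n)) : Prop :=
  iIndepFun (fun (i : Fin m) (v : ItemMatrix m n) => v i) D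

/-! ### Item pricing -/

/-- The utility of an additive buyer `j` for buying one unit of each item in `B` at prices `p`. -/
def utility {m n : ℕ} (p v : ItemMatrix m n) (j : Fin n) (B : Finset (Fin m)) : ℝ :=
  additiveValue v j (unitBundle B) - ∑ i ∈ B, p i j

open Classical in
/-- The items that buyer `j` buys when the items in `R` are left: the utility-maximizing set, where
an indifferent buyer buys (see `demand_maximizes`). -/
noncomputable def demand {m n : ℕ} (p v : ItemMatrix m n) (j : Fin n) (R : Finset (Fin m)) :
    Finset (Fin m) :=
  R.filter fun i => p i j ≤ v i j

lemma utility_eq {m n : ℕ} (p v : ItemMatrix m n) (j : Fin n) (B : Finset (Fin m)) :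
    utility p v j B = ∑ i ∈ B, (v i j - p i j) := by
  simp [utility, additiveValue, unitBundle, Finset.sum_sub_distrib, ite_mul]

/-- The demanded set maximizes the utility among all sets of available items, and it is the largest
set that does. -/
lemma demand_maximizes {m n : ℕ} (p v : ItemMatrix m n) (j : Fin n) (R : Finset (Fin m)) :
    (demand p v j R ⊆ R ∧ ∀ B ⊆ R, utility p v j B ≤ utility p v j (demand p v j R)) ∧
    ∀ B ⊆ R, (∀ B' ⊆ R, utility p v j B' ≤ utility p v j B) → B ⊆ demand p v j R := by
  classical
  refine ⟨⟨Finset.filter_subset _ _, fun B hB => ?_⟩, fun B hB hmax i hi => ?_⟩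
  · rw [utility_eq, utility_eq]
    calc ∑ i ∈ B, (v i j - p i j)
        ≤ ∑ i ∈ B, if p i j ≤ v i j then v i j - p i j else 0 := by
          refine Finset.sum_le_sum fun i _ => ?_
          split_ifs with h
          · exact le_rfl
          · linarith
      _ ≤ ∑ i ∈ R, if p i j ≤ v i j then v i j - p i j else 0 := by
          refine Finset.sum_le_sum_of_subset_of_nonneg hB fun i _ _ => ?_
          split_ifs with h
          · linarith
          · exact le_rfl
      _ = _ := by rw [demand, Finset.sum_filter]
  · have h := hmax (B.erase i) ((Finset.erase_subset _ _).trans hB)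
    rw [utility_eq, utility_eq, ← Finset.add_sum_erase B _ hi] at h
    exact Finset.mem_filter.2 ⟨hB hi, by linarith⟩

/-- The profit of item pricing when the items in `R` are left and the buyers of the list arrive
in this order: each buyer in turn buys her demanded set among the remaining items, pays its price,
and the seller bears the cost of the bundle. -/
noncomputable def sequentialProfit {m n : ℕ} (c : Bundle m → ℝ) (p v : ItemMatrix m n) :
    List (Fin n) → Finset (Fin m) → ℝ
  | [], _ => 0
  | j :: l, R =>
      ((∑ i ∈ demand p v j R, p i j) - c (unitBundle (demand p v j R))) +
        sequentialProfit c p v l (R \ demand p v j R)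

/-- The profit of the item-pricing mechanism with prices `p` on the values `v`; there is one unit of
each item, and the buyers arrive in the order `ord 0, ord 1, …, ord (n - 1)`. -/
noncomputable def itemPricingProfit {m n : ℕ} (c : Bundle m → ℝ) (ord : Equiv.Perm (Fin n))
    (p v : ItemMatrix m n) : ℝ :=
  sequentialProfit c p v ((List.finRange n).map ord) Finset.univ

/-! ### Second-price item auctions with reserves -/

/-- `w i b` is a highest bidder for item `i` under the bids `b`; it is the bidder that the auction
treats as the highest one, so `w` fixes how ties are broken. -/
def IsHighestBidderRule {m n : ℕ} (w : Fin m → (Fin n → ℝ) → Fin n) : Prop :=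
  ∀ (i : Fin m) (b : Fin n → ℝ) (j : Fin n), b j ≤ b (w i b)

open Classical in
/-- The items that bidder `j` wins: those where she is the highest bidder and bids at least her
reserve price. -/
noncomputable def wonItems {m n : ℕ} (w : Fin m → (Fin n → ℝ) → Fin n) (p v : ItemMatrix m n)
    (j : Fin n) : Finset (Fin m) :=
  Finset.univ.filter fun i => w i (v i) = j ∧ p i j ≤ v i j

/-- The payment of a winner `j` of an item with reserves `r` and bids `b`: the maximum of her
reserve and of the second highest bid, that is, of the bids of all the others. -/
noncomputable def secondPricePayment {n : ℕ} (r b : Fin n → ℝ) (j : Fin n) : ℝ :=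
  (Finset.univ.erase j).fold max (r j) b

/-- The profit of the second-price item auction with reserves `p` on the values `v`. -/
noncomputable def secondPriceProfit {m n : ℕ} (c : Bundle m → ℝ)
    (w : Fin m → (Fin n → ℝ) → Fin n) (p v : ItemMatrix m n) : ℝ :=
  ∑ j, ((∑ i ∈ wonItems w p v j, secondPricePayment (p i) (v i) j) -
    c (unitBundle (wonItems w p v j)))

/-! ### Price classes, maximum profit, and Rademacher complexity -/

/-- Anonymous prices (or reserves): one price `q i ∈ P i` per item, the same for every buyer. -/
def anonymousPrices {m : ℕ} (n : ℕ) (P : Fin m → Set ℝ) : Set (ItemMatrix m n) :=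
  {p | ∃ q : Fin m → ℝ, (∀ i, q i ∈ P i) ∧ ∀ i j, p i j = q i}

/-- Non-anonymous prices (or reserves): a vector `p i ∈ P i` of `n` buyer-specific prices per
item. -/
def nonAnonymousPrices {m n : ℕ} (P : Fin m → Set (Fin n → ℝ)) : Set (ItemMatrix m n) :=
  {p | ∀ i, p i ∈ P i}

/-- The absolute profits that the mechanisms of a class attain on a set `X` of buyers' values. A
class is given by its set of profit functions. -/
def absProfits {V : Type*} (M : Set (V → ℝ)) (X : Set V) : Set ℝ :=
  {r | ∃ f ∈ M, ∃ v ∈ X, r = |f v|}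

/-- The maximum profit `U`, in absolute value, of a class on a set `X` of buyers' values. -/
noncomputable def maxProfit {V : Type*} (M : Set (V → ℝ)) (X : Set V) : ℝ :=
  sSup (absProfits M X)

/-- The empirical Rademacher complexity of a class of functions over a sample `S` of size `N`:
the expectation, over independent uniform signs `σ`, of the supremum over the class of
`(1/N) ∑ k, σ k * f (S k)`. -/
noncomputable def empiricalRademacher {V : Type*} {N : ℕ} (M : Set (V → ℝ)) (S : Fin N → V) : ℝ :=
  (1 / 2 ^ N) * ∑ σ : Fin N → ℤˣ, ⨆ f : M, (1 / N) * ∑ k, ((σ k : ℤ) : ℝ) * f.1 (S k)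

/-! Costs and values are additive, so the profit is a sum over items, the term of item `i` depending
only on the prices and values of item `i`. The supremum of a sum is at most the sum of the suprema,
hence the Rademacher complexity is at most the sum of the complexities of the items.

Let `W i` be the length of an interval containing the profits from item `i` over all allowed prices
and all sampled values. Item independence makes the support a product set
(`ItemIndependent.mix_mem_support`), so near-extremal prices and sampled values can be chosen for
each item separately and glued into one mechanism and one point of the support. Therefore the
suprema of the item profits add up to at most `U`, and so do those of their negatives: `∑ i, W i ≤ 2
* U`, without a factor `m`.

It remains to bound one item by a multiple of `W i * √(d * log (3 * d) / N)`, where `d` is the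
number of relevant prices. The profit depends on which thresholds the prices pass and on at most one
price. Two price vectors are thus close in the empirical `L²` distance once their acceptance rates
and their clipped positions agree on a grid (`sum_sq_sub_le_of_priceCell_eq`). The number of cells
at each scale does not depend on `N`, so chaining (`signSup_le_of_chain`) costs no `log N`.
Non-anonymous prices have `d = n`. Anonymous ones have `d = 1`, because someone accepts a common
price exactly when the highest value reaches it. -/

open MeasureTheory ProbabilityTheory

/-! ### Sign averages and Massart's lemma -/

/-- The average of `φ` over independent uniform signs. -/
noncomputable def signAverage {N : ℕ} (φ : (Fin N → ℤˣ) → ℝ) : ℝ :=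
  (1 / 2 ^ N) * ∑ σ, φ σ

/-- The correlation of a vector with a sign pattern. -/
def signSum {N : ℕ} (σ : Fin N → ℤˣ) (u : Fin N → ℝ) : ℝ :=
  ∑ k, ((σ k : ℤ) : ℝ) * u k

lemma signAverage_mono {N : ℕ} {φ ψ : (Fin N → ℤˣ) → ℝ} (h : ∀ σ, φ σ ≤ ψ σ) :
    signAverage φ ≤ signAverage ψ :=
  mul_le_mul_of_nonneg_left (Finset.sum_le_sum fun σ _ => h σ) (by positivity)

lemma signAverage_add {N : ℕ} (φ ψ : (Fin N → ℤˣ) → ℝ) :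
    signAverage (fun σ => φ σ + ψ σ) = signAverage φ + signAverage ψ := by
  simp [signAverage, Finset.sum_add_distrib, mul_add]

lemma signAverage_const_mul {N : ℕ} (a : ℝ) (φ : (Fin N → ℤˣ) → ℝ) :
    signAverage (fun σ => a * φ σ) = a * signAverage φ := by
  simp [signAverage, ← Finset.mul_sum]; ring

lemma signAverage_sum {N : ℕ} {ι : Type*} (s : Finset ι) (φ : ι → (Fin N → ℤˣ) → ℝ) :
    signAverage (fun σ => ∑ i ∈ s, φ i σ) = ∑ i ∈ s, signAverage (φ i) := by
  simp only [signAverage]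
  rw [Finset.sum_comm, Finset.mul_sum]

lemma signAverage_const {N : ℕ} (a : ℝ) : signAverage (fun _ : Fin N → ℤˣ => a) = a := by
  simp [signAverage]

lemma sum_intUnits {M : Type*} [AddCommMonoid M] (φ : ℤˣ → M) : ∑ s, φ s = φ 1 + φ (-1) := by
  have : (Finset.univ : Finset ℤˣ) = {1, -1} := by decide
  rw [this, Finset.sum_pair (by decide)]

lemma signAverage_exp_signSum {N : ℕ} (u : Fin N → ℝ) :
    signAverage (fun σ => Real.exp (signSum σ u)) = ∏ k, Real.cosh (u k) := by
  have h := Fintype.prod_sum (fun (k : Fin N) (s : ℤˣ) => Real.exp (((s : ℤ) : ℝ) * u k))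
  simp only [signAverage, signSum, Real.exp_sum]
  rw [← h]
  simp only [sum_intUnits, Real.cosh_eq, Finset.prod_div_distrib]
  simp
  field_simp

lemma signAverage_signSum {N : ℕ} (u : Fin N → ℝ) : signAverage (fun σ => signSum σ u) = 0 := by
  have h : ∑ σ : Fin N → ℤˣ, signSum σ u = -∑ σ : Fin N → ℤˣ, signSum σ u := by
    conv_lhs => rw [← Equiv.sum_comp (Equiv.neg (Fin N → ℤˣ))]
    simp [signSum]
  rw [signAverage, show ∑ σ : Fin N → ℤˣ, signSum σ u = 0 by linarith, mul_zero]

lemma signSum_add {N : ℕ} (σ : Fin N → ℤˣ) (u w : Fin N → ℝ) :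
    signSum σ (u + w) = signSum σ u + signSum σ w := by
  simp [signSum, mul_add, Finset.sum_add_distrib]

lemma signSum_smul {N : ℕ} (σ : Fin N → ℤˣ) (t : ℝ) (u : Fin N → ℝ) :
    signSum σ (t • u) = t * signSum σ u := by
  simp only [signSum, Pi.smul_apply, smul_eq_mul, Finset.mul_sum]
  exact Finset.sum_congr rfl fun k _ => by ring

lemma abs_signSum_le {N : ℕ} (σ : Fin N → ℤˣ) (u : Fin N → ℝ) :
    |signSum σ u| ≤ √N * √(∑ k, u k ^ 2) := by
  have h := Finset.sum_mul_sq_le_sq_mul_sq Finset.univ (fun k => ((σ k : ℤ) : ℝ)) u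
  have h1 : ∀ s : ℤˣ, ((s : ℤ) : ℝ) ^ 2 = 1 := fun s => by
    rcases Int.units_eq_one_or s with h | h <;> simp [h]
  simp only [h1] at h
  rw [← Real.sqrt_mul (by positivity)]
  exact Real.abs_le_sqrt (by simpa [signSum] using h)

/-- A Rademacher average is subgaussian. -/
lemma signAverage_exp_le {N : ℕ} (t R : ℝ) (u : Fin N → ℝ) (hu : ∑ k, u k ^ 2 ≤ R ^ 2) :
    signAverage (fun σ => Real.exp (t * signSum σ u)) ≤ Real.exp (t ^ 2 * R ^ 2 / 2) := by
  simp only [← signSum_smul]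
  rw [signAverage_exp_signSum]
  calc ∏ k, Real.cosh ((t • u) k) ≤ ∏ k, Real.exp ((t • u) k ^ 2 / 2) :=
        Finset.prod_le_prod (fun k _ => (Real.cosh_pos _).le) fun k _ => Real.cosh_le_exp_half_sq _
    _ = Real.exp (t ^ 2 * (∑ k, u k ^ 2) / 2) := by
        rw [← Real.exp_sum]
        congr 1
        rw [Finset.mul_sum, Finset.sum_div]
        exact Finset.sum_congr rfl fun k _ => by simp [mul_pow]
    _ ≤ _ := by gcongr

/-- Massart's finite class lemma. -/
lemma signAverage_le_of_finite {N : ℕ} (A : Finset (Fin N → ℝ)) {R H : ℝ} (hR : 0 < R) (hH : 0 < H)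
    (hA : ∀ u ∈ A, ∑ k, u k ^ 2 ≤ R ^ 2) (hcard : (A.card : ℝ) ≤ Real.exp H)
    (φ : (Fin N → ℤˣ) → ℝ) (hφ : ∀ σ, ∃ u ∈ A, φ σ ≤ signSum σ u) :
    signAverage φ ≤ R * √(2 * H) := by
  set t := √(2 * H) / R with ht
  have htpos : 0 < t := by positivity
  have htR : t ^ 2 * R ^ 2 = 2 * H := by
    rw [ht, div_pow, Real.sq_sqrt (by positivity)]
    field_simp
  -- The tangent bound `x + 1 ≤ exp x` at `x = t * φ σ - 2 * H` replaces Jensen's inequality. On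
  -- average the sum is at most `exp H` terms of size `exp H`, which `exp (-(2 * H))` cancels.
  have key : ∀ σ, t * φ σ ≤ (2 * H - 1) + Real.exp (-(2 * H)) * ∑ u ∈ A, Real.exp (t * signSum σ u) := by
    intro σ
    obtain ⟨u, hu, hle⟩ := hφ σ
    have h1 := Real.add_one_le_exp (t * φ σ - 2 * H)
    have h2 : Real.exp (t * φ σ - 2 * H) ≤
        Real.exp (-(2 * H)) * ∑ u ∈ A, Real.exp (t * signSum σ u) := by
      rw [sub_eq_neg_add, Real.exp_add]
      gcongr
      calc Real.exp (t * φ σ) ≤ Real.exp (t * signSum σ u) := by gcongr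
        _ ≤ _ := Finset.single_le_sum (f := fun u => Real.exp (t * signSum σ u))
          (fun _ _ => (Real.exp_pos _).le) hu
    linarith
  have h := signAverage_mono key
  rw [signAverage_const_mul, signAverage_add, signAverage_const, signAverage_const_mul,
    signAverage_sum] at h
  have h3 : ∑ u ∈ A, signAverage (fun σ => Real.exp (t * signSum σ u)) ≤ Real.exp (2 * H) := by
    calc _ ≤ ∑ u ∈ A, Real.exp (t ^ 2 * R ^ 2 / 2) :=
          Finset.sum_le_sum fun u hu => signAverage_exp_le t R u (hA u hu)
      _ = A.card * Real.exp H := by rw [htR]; simp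
      _ ≤ Real.exp H * Real.exp H := by gcongr
      _ = _ := by rw [← Real.exp_add]; ring_nf
  have h4 : Real.exp (-(2 * H)) *
      ∑ u ∈ A, signAverage (fun σ => Real.exp (t * signSum σ u)) ≤ 1 := by
    calc _ ≤ Real.exp (-(2 * H)) * Real.exp (2 * H) := by gcongr
      _ = 1 := by rw [← Real.exp_add]; simp
  have h5 : t * signAverage φ ≤ 2 * H := by linarith
  have h6 : t * (R * √(2 * H)) = 2 * H := by
    rw [ht]; field_simp; exact Real.sq_sqrt (by positivity)
  exact le_of_mul_le_mul_left (h5.trans_eq h6.symm) htpos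

/-! ### Suprema of Rademacher processes and chaining -/

/-- The expected supremum of a Rademacher process. -/
noncomputable def signSup {N : ℕ} {Θ : Type*} (a : Θ → Fin N → ℝ) : ℝ :=
  signAverage fun σ => ⨆ θ, signSum σ (a θ)

lemma bddAbove_signSum {N : ℕ} {Θ : Type*} {a : Θ → Fin N → ℝ} {R : ℝ}
    (h : ∀ θ, ∑ k, a θ k ^ 2 ≤ R) (σ : Fin N → ℤˣ) :
    BddAbove (Set.range fun θ => signSum σ (a θ)) := by
  refine ⟨√N * √R, ?_⟩
  rintro _ ⟨θ, rfl⟩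
  exact (le_abs_self _).trans ((abs_signSum_le σ _).trans (by gcongr; exact h θ))

lemma signSup_add_le {N : ℕ} {Θ : Type*} [Nonempty Θ] {a b : Θ → Fin N → ℝ} {R R' : ℝ}
    (ha : ∀ θ, ∑ k, a θ k ^ 2 ≤ R) (hb : ∀ θ, ∑ k, b θ k ^ 2 ≤ R') :
    signSup (fun θ => a θ + b θ) ≤ signSup a + signSup b := by
  rw [signSup, signSup, signSup, ← signAverage_add]
  refine signAverage_mono fun σ => ciSup_le fun θ => ?_
  rw [signSum_add]
  exact add_le_add (le_ciSup (bddAbove_signSum ha σ) θ) (le_ciSup (bddAbove_signSum hb σ) θ)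

lemma signSup_le_of_finite {N : ℕ} {Θ : Type*} [Nonempty Θ] {a : Θ → Fin N → ℝ} {R H : ℝ}
    (hR : 0 < R) (hH : 0 < H) (ha : ∀ θ, ∑ k, a θ k ^ 2 ≤ R ^ 2) (hfin : (Set.range a).Finite)
    (hcard : ((Set.range a).ncard : ℝ) ≤ Real.exp H) : signSup a ≤ R * √(2 * H) := by
  refine signAverage_le_of_finite hfin.toFinset hR hH ?_ ?_ _ fun σ => ?_
  · intro u hu
    obtain ⟨θ, rfl⟩ := (hfin.mem_toFinset).1 hu
    exact ha θ
  · rwa [← Set.ncard_eq_toFinset_card _ hfin]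
  · have hf : (Set.range fun θ => signSum σ (a θ)).Finite := by
      have : (Set.range fun θ => signSum σ (a θ)) = signSum σ '' Set.range a := by
        rw [← Set.range_comp]; rfl
      rw [this]; exact hfin.image _
    obtain ⟨θ, hθ⟩ := (Set.range_nonempty _).csSup_mem hf
    exact ⟨a θ, by simp, hθ.ge⟩

/-- Cauchy–Schwarz for each sign pattern, with no use of cancellation. It handles the remainder
below the finest scale of the chain, where no cardinality bound is available. -/
lemma signSup_le_of_sq_le {N : ℕ} {Θ : Type*} [Nonempty Θ] {a : Θ → Fin N → ℝ} {R : ℝ}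
    (hR : 0 ≤ R) (ha : ∀ θ, ∑ k, a θ k ^ 2 ≤ R ^ 2) : signSup a ≤ √N * R := by
  rw [← signAverage_const (N := N) (√N * R)]
  refine signAverage_mono fun σ => ciSup_le fun θ => ?_
  refine (le_abs_self _).trans ((abs_signSum_le σ _).trans ?_)
  gcongr
  exact (Real.sqrt_le_left hR).2 (ha θ)

lemma sum_sq_add_le {ι : Type*} [Fintype ι] {u w : ι → ℝ} {R R' : ℝ} (hR : 0 ≤ R) (hR' : 0 ≤ R')
    (hu : ∑ k, u k ^ 2 ≤ R ^ 2) (hw : ∑ k, w k ^ 2 ≤ R' ^ 2) :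
    ∑ k, (u + w) k ^ 2 ≤ (R + R') ^ 2 := by
  have h := Finset.sum_mul_sq_le_sq_mul_sq Finset.univ u w
  have h1 : (∑ k, u k * w k) ≤ R * R' := by
    refine abs_le_of_sq_le_sq' (h.trans ?_) (by positivity) |>.2
    rw [mul_pow]
    gcongr
  have : ∑ k, (u + w) k ^ 2 = ∑ k, u k ^ 2 + 2 * ∑ k, u k * w k + ∑ k, w k ^ 2 := by
    rw [Finset.mul_sum, ← Finset.sum_add_distrib, ← Finset.sum_add_distrib]
    exact Finset.sum_congr rfl fun k _ => by simp; ring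
  rw [this]; nlinarith

lemma sum_add_one_div_two_pow_le (L : ℕ) : ∑ l ∈ Finset.range L, ((l : ℝ) + 1) / 2 ^ l ≤ 4 := by
  suffices h : ∑ l ∈ Finset.range L, ((l : ℝ) + 1) / 2 ^ l = 4 - (2 * L + 4) / 2 ^ L by
    rw [h]; have : 0 ≤ (2 * (L : ℝ) + 4) / 2 ^ L := by positivity
    linarith
  induction L with
  | zero => simp
  | succ L ih => rw [Finset.sum_range_succ, ih]; push_cast; field_simp; ring

/-- Dudley's chaining bound, for nets at the scales `R / 2 ^ l` of metric entropy `H * (l + 1)`. -/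
theorem signSup_le_of_chain {N : ℕ} {Θ : Type*} [Nonempty Θ] {a : Θ → Fin N → ℝ} {R H : ℝ}
    (hR : 0 < R) (hH : 0 < H) (net : ℕ → Θ → Θ) (h0 : ∃ θ₀, ∀ θ, net 0 θ = θ₀)
    (hfin : ∀ l, (Set.range (net l)).Finite)
    (hcard : ∀ l, ((Set.range (net l)).ncard : ℝ) ≤ Real.exp (H * (l + 1)))
    (hdist : ∀ l θ, ∑ k, (a θ - a (net l θ)) k ^ 2 ≤ (R / 2 ^ l) ^ 2) (L : ℕ) :
    signSup a ≤ 10 * R * √(6 * H) + √N * (R / 2 ^ L) := by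
  obtain ⟨θ₀, hθ₀⟩ := h0
  -- Every `a θ` is within `R` of `a θ₀`. This uniform bound keeps all suprema finite; its size does
  -- not enter the result.
  have hbase : ∀ l, ∀ θ, ∑ k, a (net l θ) k ^ 2 ≤ (√(∑ k, a θ₀ k ^ 2) + R) ^ 2 := by
    intro l θ
    have h1 := hdist 0 (net l θ)
    rw [hθ₀] at h1
    have h2 := sum_sq_add_le (Real.sqrt_nonneg _) hR.le
      (Real.sq_sqrt (show (0 : ℝ) ≤ ∑ k, a θ₀ k ^ 2 by positivity)).ge (by simpa using h1)
    simpa using h2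
  have hneg : ∀ l θ, ∑ k, (a (net l θ) - a θ) k ^ 2 ≤ (R / 2 ^ l) ^ 2 := by
    intro l θ
    refine le_trans (le_of_eq (Finset.sum_congr rfl fun k _ => ?_)) (hdist l θ)
    simp; ring
  have hincr : ∀ l θ, ∑ k, (a (net (l + 1) θ) - a (net l θ)) k ^ 2 ≤ (2 * R / 2 ^ l) ^ 2 := by
    intro l θ
    have h := sum_sq_add_le (by positivity) (by positivity) (hneg (l + 1) θ) (hdist l θ)
    rw [sub_add_sub_cancel] at h
    refine h.trans (pow_le_pow_left₀ (by positivity) ?_ 2)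
    rw [pow_succ, ← div_div]
    have : 0 < R / 2 ^ l := by positivity
    rw [mul_div_assoc]; linarith
  -- Massart's lemma for the links between consecutive nets. There are at most `exp (H * (l + 2)) *
  -- exp (H * (l + 1)) ≤ exp (3 * H * (l + 1))` of them, and `√(l + 1) ≤ l + 1`.
  have hstep : ∀ l, signSup (fun θ => a (net (l + 1) θ) - a (net l θ)) ≤
      2 * R * √(6 * H) * ((l + 1) / 2 ^ l) := by
    intro l
    have hsub : (Set.range fun θ => a (net (l + 1) θ) - a (net l θ)) ⊆
        (fun q : Θ × Θ => a q.1 - a q.2) '' (Set.range (net (l + 1)) ×ˢ Set.range (net l)) := by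
      rintro _ ⟨θ, rfl⟩
      exact ⟨(net (l + 1) θ, net l θ), by simp, rfl⟩
    have hfp := (hfin (l + 1)).prod (hfin l)
    have h := signSup_le_of_finite (a := fun θ => a (net (l + 1) θ) - a (net l θ))
      (R := 2 * R / 2 ^ l) (H := 3 * H * (l + 1)) (by positivity) (by positivity) (hincr l)
      ((hfp.image _).subset hsub) ?_
    · refine h.trans ?_
      have h1 : √(2 * (3 * H * (l + 1))) ≤ √(6 * H) * (l + 1) := by
        rw [show 2 * (3 * H * ((l : ℝ) + 1)) = (6 * H) * (l + 1) by ring,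
          Real.sqrt_mul (by positivity)]
        gcongr
        rw [Real.sqrt_le_left (by positivity)]
        nlinarith [(Nat.cast_nonneg l : (0 : ℝ) ≤ l)]
      calc _ ≤ 2 * R / 2 ^ l * (√(6 * H) * (l + 1)) := by gcongr
        _ = _ := by ring
    · calc ((Set.range fun θ => a (net (l + 1) θ) - a (net l θ)).ncard : ℝ)
          ≤ ((Set.range (net (l + 1)) ×ˢ Set.range (net l)).ncard : ℝ) := by
            exact_mod_cast (Set.ncard_le_ncard hsub (hfp.image _)).trans (Set.ncard_image_le hfp)
        _ = ((Set.range (net (l + 1))).ncard : ℝ) * (Set.range (net l)).ncard := by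
            rw [Set.ncard_prod]; push_cast; rfl
        _ ≤ Real.exp (H * ((l + 1 : ℕ) + 1)) * Real.exp (H * (l + 1)) := by
            gcongr
            · exact hcard (l + 1)
            · exact hcard l
        _ ≤ _ := by
            rw [← Real.exp_add]
            gcongr
            push_cast
            nlinarith [(Nat.cast_nonneg l : (0 : ℝ) ≤ l)]
  have hlevel : ∀ l, signSup (fun θ => a (net l θ)) ≤
      2 * R * √(6 * H) * ∑ i ∈ Finset.range l, ((i : ℝ) + 1) / 2 ^ i := by
    intro l
    induction l with
    -- The coarsest net is a single point, whose sign sum has mean zero.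
    | zero => simp [hθ₀, signSup, ciSup_const, signAverage_signSum]
    | succ l ih =>
      rw [Finset.sum_range_succ, mul_add]
      refine le_trans ?_ (add_le_add ih (hstep l))
      have h := signSup_add_le (hbase l) (hincr l)
      simpa using h
  have h := signSup_add_le (hbase L) (hdist L)
  simp only [add_sub_cancel] at h
  refine h.trans (add_le_add ((hlevel L).trans ?_) (signSup_le_of_sq_le (by positivity) (hdist L)))
  have h4 := sum_add_one_div_two_pow_le L
  have : 0 ≤ R * √(6 * H) := by positivity
  nlinarith

/-! ### Nets for posted-price profits -/

/-- The cell of a point of `[0, 1]` in the grid of mesh `1 / K`. -/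
noncomputable def gridCell (K : ℕ) (y : ℝ) : Fin (K + 1) := Fin.ofNat (K + 1) ⌊K * y⌋₊

lemma abs_sub_le_of_gridCell_eq {K : ℕ} (hK : 0 < K) {y z : ℝ} (hy : y ∈ Set.Icc 0 1)
    (hz : z ∈ Set.Icc 0 1) (h : gridCell K y = gridCell K z) : |y - z| ≤ 1 / K := by
  have hK' : (0 : ℝ) < K := by exact_mod_cast hK
  -- On `[0, 1]` the floor is at most `K`, so the reduction modulo `K + 1` in `gridCell` is
  -- harmless.
  have hlt : ∀ t : ℝ, t ∈ Set.Icc (0 : ℝ) 1 → ⌊K * t⌋₊ < K + 1 := fun t ht => by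
    rw [Nat.lt_succ_iff]
    exact Nat.floor_le_of_le (by nlinarith [ht.2])
  have h' : ⌊K * y⌋₊ = ⌊K * z⌋₊ := by
    have := congrArg Fin.val h
    simpa [gridCell, Fin.ofNat, Nat.mod_eq_of_lt (hlt y hy), Nat.mod_eq_of_lt (hlt z hz)] using this
  have hy1 := Nat.floor_le (mul_nonneg hK'.le hy.1)
  have hz1 := Nat.floor_le (mul_nonneg hK'.le hz.1)
  have hy2 := Nat.lt_floor_add_one (K * y)
  have hz2 := Nat.lt_floor_add_one (K * z)
  rw [h'] at hy1 hy2
  rw [abs_le, neg_le, le_div_iff₀ hK', le_div_iff₀ hK']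
  constructor <;> nlinarith

/-- Two thresholds disagree on as many points as their acceptance counts differ. -/
lemma sum_threshold_disagree_le {N : ℕ} (x : Fin N → ℝ) (s t : ℝ) [DecidablePred (s ≤ x ·)]
    [DecidablePred (t ≤ x ·)] :
    ∑ k, (if (s ≤ x k ↔ t ≤ x k) then (0 : ℝ) else 1) ≤
      |(∑ k, if s ≤ x k then (1 : ℝ) else 0) - ∑ k, if t ≤ x k then (1 : ℝ) else 0| := by
  rw [← Finset.sum_sub_distrib]
  -- The acceptance sets are nested, so all terms of the difference have the same sign.
  rcases le_total s t with h | h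
  · refine le_trans (Finset.sum_le_sum fun k _ => ?_) (le_abs_self _)
    have := fun h' : t ≤ x k => h.trans h'
    split_ifs <;> grind
  · refine le_trans ?_ (neg_le_abs _)
    rw [← Finset.sum_neg_distrib]
    refine Finset.sum_le_sum fun k _ => ?_
    have := fun h' : s ≤ x k => h.trans h'
    split_ifs <;> grind

/-- The position in `[0, 1]` of a price clipped to an interval of length `W`. -/
noncomputable def clipPosition (a W s : ℝ) : ℝ := (max a (min (a + W) s) - a) / W

lemma clipPosition_mem {a W : ℝ} (hW : 0 < W) (s : ℝ) : clipPosition a W s ∈ Set.Icc 0 1 := by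
  refine ⟨div_nonneg (by simp) hW.le, (div_le_one hW).2 ?_⟩
  have : max a (min (a + W) s) ≤ a + W := max_le (by linarith) (min_le_left _ _)
  linarith

/-- Clipping `u` to the interval leaves `max u r` unchanged when that maximum lies in the interval,
and `max` is 1-Lipschitz in its first argument. Thus unbounded prices are handled by a grid on a
bounded interval. -/
lemma abs_max_sub_max_le_clipPosition {a W s t r : ℝ} (hW : 0 < W)
    (hs : max s r ∈ Set.Icc a (a + W)) (ht : max t r ∈ Set.Icc a (a + W)) :
    |max s r - max t r| ≤ W * |clipPosition a W s - clipPosition a W t| := by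
  have key : ∀ u, max u r ∈ Set.Icc a (a + W) → max u r = max (max a (min (a + W) u)) r := by
    intro u hu
    rw [min_eq_right ((le_max_left _ _).trans hu.2), max_assoc, max_eq_right hu.1]
  rw [key s hs, key t ht]
  refine (abs_max_sub_max_le_abs _ _ _).trans (le_of_eq ?_)
  rw [clipPosition, clipPosition, ← sub_div, abs_div, abs_of_pos hW]
  field_simp
  congr 1; ring

open Classical in
/-- The fraction of the points `x k` at or above a threshold. -/
noncomputable def acceptanceRate {N : ℕ} (x : Fin N → ℝ) (s : ℝ) : ℝ :=
  (∑ k, if s ≤ x k then (1 : ℝ) else 0) / N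

lemma acceptanceRate_mem {N : ℕ} (x : Fin N → ℝ) (s : ℝ) :
    acceptanceRate x s ∈ Set.Icc 0 1 := by
  classical
  refine ⟨div_nonneg (Finset.sum_nonneg fun k _ => by split_ifs <;> norm_num) (by positivity),
    div_le_one_of_le₀ ?_ (by positivity)⟩
  calc _ ≤ ∑ k : Fin N, (1 : ℝ) := Finset.sum_le_sum fun k _ => by split_ifs <;> norm_num
    _ = N := by simp

/-- The profit functions `f θ`, on points indexed by `k`, of mechanisms that compare prices `p θ j`
with thresholds `x k j`: if two price vectors accept the same thresholds, then both profits are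
equal, or both are that of a sale at the same price of the same form. -/
def IsPostedPriceProfit {Θ ι κ : Type*} (p : Θ → κ → ℝ) (x : ι → κ → ℝ) (c : ℝ)
    (f : Θ → ι → ℝ) : Prop :=
  ∀ k θ θ', (∀ j, p θ j ≤ x k j ↔ p θ' j ≤ x k j) →
    f θ k = f θ' k ∨ ∃ j s, f θ k = max (p θ j) s - c ∧ f θ' k = max (p θ' j) s - c

/-- The cells of a price vector: for each price, the cells of its acceptance rate and of its
position in the interval of relevant prices. -/
noncomputable def priceCell {N d : ℕ} (x : Fin N → Fin d → ℝ) (a W : ℝ) (K : ℕ) (p : Fin d → ℝ) :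
    Fin d → Fin (K + 1) × Fin (K + 1) :=
  fun j => (gridCell K (acceptanceRate (fun k => x k j) (p j)),
    gridCell K (clipPosition a W (p j)))

/-- At points where both price vectors accept the same thresholds, the profits differ by at most `W
/ K`, by the position cells. By the rate cells, each price disagrees on at most `N / K` points, so
at most `d * N / K` points are exceptional, and each costs at most `W ^ 2`. -/
lemma sum_sq_sub_le_of_priceCell_eq {N d : ℕ} (hN : 1 ≤ N) {Θ : Type*} {p : Θ → Fin d → ℝ}
    {x : Fin N → Fin d → ℝ} {c a W : ℝ} {f : Θ → Fin N → ℝ} (hf : IsPostedPriceProfit p x c f)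
    (hW : 0 < W) (hfW : ∀ θ k, f θ k ∈ Set.Icc a (a + W)) {K : ℕ} (hK : 0 < K) {θ θ' : Θ}
    (h : priceCell x (a + c) W K (p θ) = priceCell x (a + c) W K (p θ')) :
    ∑ k, (f θ - f θ') k ^ 2 ≤ W ^ 2 * N * (d / K + 1 / K) := by
  classical
  have hN' : (0 : ℝ) < N := by exact_mod_cast hN
  have hK' : (0 : ℝ) < K := by exact_mod_cast hK
  have hcell := fun j => Prod.ext_iff.1 (congrFun h j)
  have hpt : ∀ k, (f θ - f θ') k ^ 2 ≤ W ^ 2 * (1 / K) +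
      W ^ 2 * ∑ j, (if (p θ j ≤ x k j ↔ p θ' j ≤ x k j) then (0 : ℝ) else 1) := by
    intro k
    have hnn : ∀ j, 0 ≤ (if (p θ j ≤ x k j ↔ p θ' j ≤ x k j) then (0 : ℝ) else 1) :=
      fun j => by split_ifs <;> norm_num
    have hsum := Finset.sum_nonneg fun j (_ : j ∈ Finset.univ) => hnn j
    simp only [Pi.sub_apply]
    by_cases hpat : ∀ j, p θ j ≤ x k j ↔ p θ' j ≤ x k j
    · refine le_add_of_le_of_nonneg ?_ (mul_nonneg (sq_nonneg W) hsum)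
      rcases hf k θ θ' hpat with heq | ⟨j, s, h1, h2⟩
      · rw [heq, sub_self, zero_pow two_ne_zero]; positivity
      · have hm1 := hfW θ k
        have hm2 := hfW θ' k
        rw [h1] at hm1
        rw [h2] at hm2
        have hb := abs_max_sub_max_le_clipPosition (a := a + c) (W := W) (s := p θ j)
          (t := p θ' j) (r := s) hW ⟨by linarith [hm1.1], by linarith [hm1.2]⟩
          ⟨by linarith [hm2.1], by linarith [hm2.2]⟩
        have hg := abs_sub_le_of_gridCell_eq hK (clipPosition_mem hW _) (clipPosition_mem hW _)
          (hcell j).2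
        have hK1 : (1 : ℝ) / K ≤ 1 := by
          rw [div_le_one hK']; exact_mod_cast hK
        have h3 : |f θ k - f θ' k| ≤ W * (1 / K) := by
          rw [h1, h2, sub_sub_sub_cancel_right]
          exact hb.trans (by gcongr)
        calc (f θ k - f θ' k) ^ 2 = |f θ k - f θ' k| ^ 2 := (sq_abs _).symm
          _ ≤ (W * (1 / K)) ^ 2 := by gcongr
          _ = W ^ 2 * (1 / K) * (1 / K) := by ring
          _ ≤ W ^ 2 * (1 / K) * 1 := by gcongr
          _ = _ := mul_one _
    · refine le_add_of_nonneg_of_le (by positivity) ?_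
      push Not at hpat
      obtain ⟨j, hj⟩ := hpat
      have h1 : (1 : ℝ) ≤ ∑ j, (if (p θ j ≤ x k j ↔ p θ' j ≤ x k j) then (0 : ℝ) else 1) := by
        refine le_trans (le_of_eq ?_)
          (Finset.single_le_sum (fun j _ => hnn j) (Finset.mem_univ j))
        rw [if_neg]; grind
      have h2 : (f θ k - f θ' k) ^ 2 ≤ W ^ 2 := by
        have := hfW θ k
        have := hfW θ' k
        simp only [Set.mem_Icc] at *
        apply sq_le_sq' <;> linarith
      nlinarith [sq_nonneg W]
  refine (Finset.sum_le_sum fun k _ => hpt k).trans ?_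
  rw [Finset.sum_add_distrib, Finset.sum_const, ← Finset.mul_sum, Finset.sum_comm]
  have hcount : ∀ j, ∑ k, (if (p θ j ≤ x k j ↔ p θ' j ≤ x k j) then (0 : ℝ) else 1) ≤ N / K := by
    intro j
    refine (sum_threshold_disagree_le (fun k => x k j) _ _).trans ?_
    have hg := abs_sub_le_of_gridCell_eq hK (acceptanceRate_mem _ _) (acceptanceRate_mem _ _)
      (hcell j).1
    rw [acceptanceRate, acceptanceRate, ← sub_div, abs_div, abs_of_pos hN', div_le_iff₀ hN'] at hg
    refine le_trans (le_of_eq ?_) (hg.trans_eq (by ring))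
    congr!
  have h1 := Finset.sum_le_sum fun j (_ : j ∈ (Finset.univ : Finset (Fin d))) => hcount j
  simp only [Finset.sum_const, Finset.card_univ, Fintype.card_fin, nsmul_eq_mul] at h1 ⊢
  calc _ ≤ N * (W ^ 2 * (1 / K)) + W ^ 2 * (d * (N / K)) := by gcongr
    _ = _ := by ring

/-- The expected supremum of the Rademacher process of a class of posted-price profits in an
interval of length `W` that depend on `d` prices. -/
theorem signSup_le_of_isPostedPriceProfit {N d : ℕ} (hN : 1 ≤ N) (hd : 1 ≤ d) {Θ : Type*}
    [Nonempty Θ] {p : Θ → Fin d → ℝ} {x : Fin N → Fin d → ℝ} {c a W : ℝ} {f : Θ → Fin N → ℝ}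
    (hf : IsPostedPriceProfit p x c f) (hW : 0 < W) (hfW : ∀ θ k, f θ k ∈ Set.Icc a (a + W)) :
    signSup f ≤ 51 * W * √(N * (d * Real.log (3 * d))) := by
  have hN' : (1 : ℝ) ≤ N := by exact_mod_cast hN
  have hd' : (1 : ℝ) ≤ d := by exact_mod_cast hd
  have hlog : 1 ≤ Real.log (3 * d) := by
    rw [Real.le_log_iff_exp_le (by positivity)]
    linarith [Real.exp_one_lt_d9]
  -- With this mesh `(d + 1) / K l ≤ 1 / 4 ^ l`, the squared scale needed for chaining.
  let K : ℕ → ℕ := fun l => 2 * d * 4 ^ l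
  have hK : ∀ l, 0 < K l := fun l => by positivity
  let cell : (l : ℕ) → Θ → Fin d → Fin (K l + 1) × Fin (K l + 1) :=
    fun l θ => priceCell x (a + c) W (K l) (p θ)
  let θ₀ : Θ := Classical.arbitrary Θ
  -- Each nonempty cell is represented by one of its own members, so the nets stay inside the class.
  let net : ℕ → Θ → Θ := fun l θ => if l = 0 then θ₀ else Function.invFun (cell l) (cell l θ)
  have hnet0 : ∀ θ, net 0 θ = θ₀ := fun θ => if_pos rfl
  have hsub : ∀ l, Set.range (net l) ⊆ {θ₀} ∨
      Set.range (net l) ⊆ Function.invFun (cell l) '' Set.univ := by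
    intro l
    rcases eq_or_ne l 0 with rfl | hl
    · left; rintro _ ⟨θ, rfl⟩; exact hnet0 θ
    · right; rintro _ ⟨θ, rfl⟩; simp [net, hl]
  have hfin : ∀ l, (Set.range (net l)).Finite := by
    intro l
    rcases hsub l with h | h
    · exact (Set.finite_singleton _).subset h
    · exact (Set.finite_univ.image _).subset h
  have hcard : ∀ l, (Set.range (net l)).ncard ≤ (3 * d) ^ (4 * d * (l + 1)) := by
    intro l
    rcases hsub l with h | h
    · refine (Set.ncard_le_ncard h).trans ?_
      rw [Set.ncard_singleton]
      exact Nat.one_le_pow _ _ (by omega)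
    · refine ((Set.ncard_le_ncard h (Set.finite_univ.image _)).trans
        (Set.ncard_image_le Set.finite_univ)).trans ?_
      rw [Set.ncard_univ, Nat.card_eq_fintype_card]
      simp only [Fintype.card_pi, Fintype.card_prod, Fintype.card_fin, Finset.prod_const,
        Finset.card_univ]
      have h1 : K l + 1 ≤ (3 * d) ^ (2 * (l + 1)) := by
        have h4 : (1 : ℕ) ≤ 4 ^ l := Nat.one_le_pow _ _ (by norm_num)
        calc K l + 1 ≤ 3 * d * 4 ^ l := by simp only [K]; nlinarith
          _ ≤ (3 * d) ^ 2 * ((3 * d) ^ 2) ^ l := by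
            gcongr
            · nlinarith
            · nlinarith
          _ = _ := by rw [← pow_mul, ← pow_add]; ring_nf
      calc ((K l + 1) * (K l + 1)) ^ d
          ≤ ((3 * d) ^ (2 * (l + 1)) * (3 * d) ^ (2 * (l + 1))) ^ d := by gcongr
        _ = _ := by rw [← pow_add, ← pow_mul]; ring_nf
  have hdist : ∀ l θ, ∑ k, (f θ - f (net l θ)) k ^ 2 ≤ (W * √N / 2 ^ l) ^ 2 := by
    intro l θ
    have hR : (W * √N / 2 ^ l) ^ 2 = W ^ 2 * N / 4 ^ l := by
      rw [div_pow, mul_pow, Real.sq_sqrt (by positivity), ← pow_mul, mul_comm l 2, pow_mul]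
      norm_num
    rw [hR]
    rcases eq_or_ne l 0 with rfl | hl
    · calc _ ≤ ∑ k : Fin N, W ^ 2 := by
            refine Finset.sum_le_sum fun k _ => ?_
            have := hfW θ k
            have := hfW (net 0 θ) k
            simp only [Set.mem_Icc, Pi.sub_apply] at *
            apply sq_le_sq' <;> linarith
        _ = _ := by simp; ring
    · have hinv : cell l (net l θ) = cell l θ := by
        simp only [net, hl, if_false]
        exact Function.invFun_eq ⟨θ, rfl⟩
      refine (sum_sq_sub_le_of_priceCell_eq hN hf hW hfW (hK l) hinv.symm).trans ?_
      rw [div_eq_mul_one_div (W ^ 2 * N)]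
      gcongr
      simp only [K]
      push_cast
      rw [← add_div, div_le_div_iff₀ (by positivity) (by positivity)]
      have : (0 : ℝ) < 4 ^ l := by positivity
      nlinarith
  have hH : 0 < 4 * d * Real.log (3 * d) := by positivity
  -- Stopping at level `N` suffices since `√N / 2 ^ N ≤ 1`. The constant is `51 = 10 * 5 + 1`, from
  -- `√24 ≤ 5` and the remainder.
  have hmain := signSup_le_of_chain (a := f) (R := W * √N) (H := 4 * d * Real.log (3 * d))
    (by positivity) hH net ⟨θ₀, hnet0⟩ hfin (fun l => ?_) hdist N
  · refine hmain.trans ?_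
    have h1 : √(6 * (4 * d * Real.log (3 * d))) ≤ 5 * √(d * Real.log (3 * d)) := by
      rw [show (5 : ℝ) = √25 by rw [show (25 : ℝ) = 5 ^ 2 by norm_num]; simp,
        ← Real.sqrt_mul (by norm_num)]
      apply Real.sqrt_le_sqrt
      nlinarith [mul_nonneg (zero_le_one.trans hd') (zero_le_one.trans hlog)]
    have h2 : √N / 2 ^ N ≤ 1 := by
      rw [div_le_one (by positivity)]
      have h3 : (N : ℝ) ≤ 2 ^ N := by exact_mod_cast Nat.lt_two_pow_self.le
      exact (Real.sqrt_le_iff.2 ⟨by positivity, by nlinarith⟩).trans h3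
    have h3 : 1 ≤ √(d * Real.log (3 * d)) := by
      rw [Real.one_le_sqrt]; nlinarith
    rw [Real.sqrt_mul (by positivity) (d * Real.log (3 * d))]
    calc _ = 10 * (W * √N) * √(6 * (4 * d * Real.log (3 * d))) + W * √N * (√N / 2 ^ N) * 1 := by
          ring
      _ ≤ 10 * (W * √N) * (5 * √(d * Real.log (3 * d))) +
          W * √N * 1 * √(d * Real.log (3 * d)) := by gcongr
      _ = _ := by ring
  · calc ((Set.range (net l)).ncard : ℝ) ≤ (3 * d : ℝ) ^ (4 * d * (l + 1)) := by
          exact_mod_cast hcard l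
      _ = Real.exp (Real.log ((3 * d : ℝ) ^ (4 * d * (l + 1)))) :=
          (Real.exp_log (by positivity)).symm
      _ = _ := by rw [Real.log_pow]; push_cast; ring_nf

/-! ### Product supports and reduction to single items -/

/-- The support of an item-independent distribution is a product set. -/
lemma ItemIndependent.mix_mem_support {m n : ℕ} {D : Measure (ItemMatrix m n)}
    [IsProbabilityMeasure D] (hD : ItemIndependent D) {y : Fin m → ItemMatrix m n}
    (hy : ∀ i, y i ∈ D.support) : (fun i => y i i) ∈ D.support := by
  rw [Measure.mem_support_iff_forall]
  intro U hU
  obtain ⟨t, htU, hto, hyt⟩ := mem_nhds_iff.1 hU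
  obtain ⟨u, hu, hut⟩ := isOpen_pi_iff'.1 hto _ hyt
  refine lt_of_lt_of_le ?_ (measure_mono (hut.trans htU))
  -- Independence turns the measure of a box around the mixed point into a product. Each factor is
  -- positive, since its preimage is a neighborhood of the support point `y i`.
  have hind := iIndepFun.measure_inter_preimage_eq_mul hD Finset.univ (sets := u)
    fun i _ => (hu i).1.measurableSet
  have hset : Set.univ.pi u = ⋂ i ∈ Finset.univ, (fun v : ItemMatrix m n => v i) ⁻¹' u i := by
    ext v; simp
  rw [hset, hind]
  refine pos_iff_ne_zero.2 (Finset.prod_ne_zero_iff.2 fun i _ => ne_of_gt ?_)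
  exact (Measure.mem_support_iff_forall _).1 (hy i) _
    (((hu i).1.preimage (continuous_apply i)).mem_nhds (hu i).2)

/-- The coordinates vary independently, so near-maximizers combine into one point; the slack `ε` is
needed because the suprema may not be attained. -/
lemma sum_ciSup_le {ι : Type*} [Fintype ι] {Z : ι → Type*} [∀ i, Nonempty (Z i)]
    {h : (i : ι) → Z i → ℝ} {B : ℝ} (hB : ∀ z : (i : ι) → Z i, ∑ i, h i (z i) ≤ B) :
    ∑ i, ⨆ z, h i z ≤ B := by
  refine le_of_forall_pos_le_add fun ε hε => ?_
  have hc : (0 : ℝ) < Fintype.card ι + 1 := by positivity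
  have hz : ∀ i, ∃ z, (⨆ z, h i z) - ε / (Fintype.card ι + 1) < h i z := fun i =>
    exists_lt_of_lt_ciSup (sub_lt_self _ (by positivity))
  choose z hz using hz
  have h1 := Finset.sum_le_sum fun i (_ : i ∈ Finset.univ) => (hz i).le
  rw [Finset.sum_sub_distrib] at h1
  have h2 : ∑ _i : ι, ε / ((Fintype.card ι : ℝ) + 1) ≤ ε := by
    simp only [Finset.sum_const, Finset.card_univ, nsmul_eq_mul]
    rw [mul_div_assoc', div_le_iff₀ hc]
    nlinarith
  linarith [hB z]

lemma bddAbove_range_of_sum_le {ι : Type*} [Fintype ι] {Z : ι → Type*} [∀ i, Nonempty (Z i)]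
    {h : (i : ι) → Z i → ℝ} {B : ℝ} (hB : ∀ z : (i : ι) → Z i, ∑ i, h i (z i) ≤ B) (i : ι) :
    BddAbove (Set.range (h i)) := by
  classical
  let z₀ : (i : ι) → Z i := fun i => Classical.arbitrary _
  refine ⟨B - ∑ i' ∈ Finset.univ.erase i, h i' (z₀ i'), ?_⟩
  rintro _ ⟨z, rfl⟩
  have h1 := hB (Function.update z₀ i z)
  rw [← Finset.add_sum_erase _ _ (Finset.mem_univ i), Function.update_self] at h1
  have h2 : ∑ i' ∈ Finset.univ.erase i, h i' (Function.update z₀ i z i') =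
      ∑ i' ∈ Finset.univ.erase i, h i' (z₀ i') :=
    Finset.sum_congr rfl fun i' hi' => by rw [Function.update_of_ne (Finset.ne_of_mem_erase hi')]
  linarith

lemma maxProfit_nonneg {V : Type*} (M : Set (V → ℝ)) (X : Set V) : 0 ≤ maxProfit M X :=
  Real.sSup_nonneg (by rintro _ ⟨f, _, v, _, rfl⟩; exact abs_nonneg _)

lemma empiricalRademacher_eq {V : Type*} {N : ℕ} (M : Set (V → ℝ)) (S : Fin N → V) :
    empiricalRademacher M S = (1 / N) * signSup (fun (f : M) k => f.1 (S k)) := by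
  rw [signSup, ← signAverage_const_mul]
  simp only [empiricalRademacher, signAverage, signSum]
  congr 1
  refine Finset.sum_congr rfl fun σ _ => ?_
  rw [Real.mul_iSup_of_nonneg (by positivity)]

/-- The Rademacher complexity of a class of mechanisms that price the items separately, when the
profit from each item is a posted-price profit in `d` prices. -/
theorem empiricalRademacher_le_of_itemwise {m n N d : ℕ} (hN : 1 ≤ N) (hd : 1 ≤ d)
    {D : Measure (ItemMatrix m n)} [IsProbabilityMeasure D] (hD : ItemIndependent D)
    {S : Fin N → ItemMatrix m n} (hS : ∀ k, S k ∈ D.support)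
    (g : Fin m → (Fin n → ℝ) → (Fin n → ℝ) → ℝ) (c : Fin m → ℝ) (P : Fin m → Set (Fin n → ℝ))
    {M : Set (ItemMatrix m n → ℝ)}
    (hM : M = (fun p v => ∑ i, g i (p i) (v i)) '' nonAnonymousPrices P)
    (hU : BddAbove (absProfits M D.support))
    (hg : ∀ i, ∃ (p : P i → Fin d → ℝ) (x : Fin N → Fin d → ℝ),
      IsPostedPriceProfit p x (c i) fun q k => g i q (S k i)) :
    empiricalRademacher M S ≤
      102 * (maxProfit M D.support * √(d * Real.log (3 * d) / N)) := by
  set U := maxProfit M D.support with hUdef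
  have hU0 : 0 ≤ U := maxProfit_nonneg _ _
  have hN' : (0 : ℝ) < N := by exact_mod_cast hN
  have : Nonempty (Fin N) := ⟨⟨0, hN⟩⟩
  by_cases hP : ∀ i, (P i).Nonempty
  swap
  -- An empty class has complexity `0`, the default value of a real supremum over an empty type.
  · have hempty : IsEmpty M := by
      subst hM
      simp only [not_forall] at hP
      obtain ⟨i, hi⟩ := hP
      refine ⟨fun ⟨_, p, hp, _⟩ => hi ⟨p i, hp i⟩⟩
    have h0 : empiricalRademacher M S = 0 := by
      simp [empiricalRademacher, Real.iSup_of_isEmpty]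
    rw [h0]; positivity
  have : ∀ i, Nonempty (P i) := fun i => (hP i).to_subtype
  have hpr : ∀ p : (i : Fin m) → P i, ∀ v ∈ D.support, |∑ i, g i (p i) (v i)| ≤ U := by
    intro p v hv
    refine le_csSup hU ⟨fun v => ∑ i, g i (p i) (v i), ?_, v, hv, rfl⟩
    rw [hM]
    exact ⟨fun i => p i, fun i => (p i).2, rfl⟩
  -- Each item takes its own price and its own sample point; the glued values need not occur in the
  -- sample, but they lie in the support, where `U` is a bound.
  have hmix : ∀ z : (i : Fin m) → P i × Fin N,
      |∑ i, g i (z i).1 (S (z i).2 i)| ≤ U := fun z =>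
    hpr (fun i => (z i).1) _ (hD.mix_mem_support (y := fun i => S (z i).2) fun i => hS _)
  let h : (i : Fin m) → P i × Fin N → ℝ := fun i z => g i z.1 (S z.2 i)
  have hup : ∀ z : (i : Fin m) → P i × Fin N, ∑ i, h i (z i) ≤ U :=
    fun z => (le_abs_self _).trans (hmix z)
  have hlo : ∀ z : (i : Fin m) → P i × Fin N, ∑ i, -h i (z i) ≤ U := fun z => by
    rw [Finset.sum_neg_distrib]; exact (neg_le_abs _).trans (hmix z)
  let b : Fin m → ℝ := fun i => ⨆ z, h i z
  let a : Fin m → ℝ := fun i => ⨆ z, -h i z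
  have hb : ∀ i z, h i z ≤ b i := fun i z => le_ciSup (bddAbove_range_of_sum_le hup i) z
  have ha : ∀ i z, -h i z ≤ a i := fun i z =>
    le_ciSup (f := fun z => -h i z) (bddAbove_range_of_sum_le (h := fun i z => -h i z) hlo i) z
  have hab : ∑ i, (a i + b i) ≤ 2 * U := by
    rw [Finset.sum_add_distrib]
    linarith [sum_ciSup_le hup, sum_ciSup_le (h := fun i z => -h i z) hlo]
  have hab0 : ∀ i, 0 ≤ a i + b i := fun i => by
    have z : P i × Fin N := Classical.arbitrary _
    linarith [ha i z, hb i z]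
  set Q := √(N * (d * Real.log (3 * d))) with hQ
  let F : (i : Fin m) → P i → Fin N → ℝ := fun i q k => g i q (S k i)
  have hitem : ∀ i, signSup (F i) ≤ 51 * (a i + b i) * Q := by
    intro i
    obtain ⟨p, x, hpx⟩ := hg i
    refine le_of_forall_pos_le_add fun ε hε => ?_
    -- The single-item bound needs a positive length, but the profit may be constant; the
    -- enlargement costs at most `ε`.
    have hW : 0 < a i + b i + ε / (51 * Q + 1) := by
      have := hab0 i
      have : 0 ≤ Q := Real.sqrt_nonneg _
      positivity
    refine (signSup_le_of_isPostedPriceProfit hN hd hpx (a := -a i) hW fun q k => ?_).trans ?_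
    · have h1 := ha i (q, k)
      have h2 := hb i (q, k)
      have : 0 ≤ ε / (51 * Q + 1) := by positivity
      simp only [h] at h1 h2
      constructor <;> linarith
    · rw [← hQ]
      have h3 : 51 * Q * (ε / (51 * Q + 1)) ≤ ε := by
        rw [mul_div_assoc', div_le_iff₀ (by positivity)]
        nlinarith
      linarith
  have hFbdd : ∀ i σ, BddAbove (Set.range fun q => signSum σ (F i q)) := fun i σ =>
    bddAbove_signSum (R := ∑ _k : Fin N, (|a i| + |b i|) ^ 2) (fun q => by
      refine Finset.sum_le_sum fun k _ => ?_
      have h1 := ha i (q, k)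
      have h2 := hb i (q, k)
      simp only [h] at h1 h2
      apply sq_le_sq' <;>
      linarith [le_abs_self (a i), le_abs_self (b i), abs_nonneg (a i), abs_nonneg (b i)]) σ
  have hsup : signSup (fun (f : M) k => f.1 (S k)) ≤ ∑ i, signSup (F i) := by
    simp only [signSup]
    rw [← signAverage_sum]
    refine signAverage_mono fun σ => ?_
    have : Nonempty M := by
      let p : (i : Fin m) → P i := fun i => Classical.arbitrary _
      refine ⟨⟨fun v => ∑ i, g i (p i) (v i), ?_⟩⟩
      rw [hM]
      exact ⟨fun i => p i, fun i => (p i).2, rfl⟩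
    refine ciSup_le fun f => ?_
    have hf : f.1 ∈ (fun p v => ∑ i, g i (p i) (v i)) '' nonAnonymousPrices P := hM ▸ f.2
    obtain ⟨p, hp, hfp⟩ := hf
    calc signSum σ (fun k => f.1 (S k)) = ∑ i, signSum σ (F i ⟨p i, hp i⟩) := by
          rw [← hfp]
          simp only [signSum, F, Finset.mul_sum]
          exact Finset.sum_comm
      _ ≤ _ := Finset.sum_le_sum fun i _ => le_ciSup (hFbdd i σ) ⟨p i, hp i⟩
  have htotal : signSup (fun (f : M) k => f.1 (S k)) ≤ 102 * U * Q := by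
    have h1 : ∑ i, signSup (F i) ≤ 51 * (∑ i, (a i + b i)) * Q := by
      rw [Finset.mul_sum, Finset.sum_mul]
      exact Finset.sum_le_sum fun i _ => hitem i
    have h2 : 51 * (∑ i, (a i + b i)) * Q ≤ 51 * (2 * U) * Q := by gcongr
    linarith
  have hQN : 1 / N * Q = √(d * Real.log (3 * d) / N) := by
    have : (d * Real.log (3 * d)) / (N : ℝ) = (N * (d * Real.log (3 * d))) / N ^ 2 := by
      field_simp
    rw [this, Real.sqrt_div' _ (by positivity), Real.sqrt_sq hN'.le, hQ]
    ring
  rw [empiricalRademacher_eq, ← hQN]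
  calc _ ≤ 1 / (N : ℝ) * (102 * U * Q) := by gcongr
    _ = _ := by ring

/-! ### Itemwise form of the two mechanisms -/

lemma IsAdditiveCost.unitBundle_eq {m : ℕ} {c : Bundle m → ℝ} (hc : IsAdditiveCost c)
    (B : Finset (Fin m)) : c (unitBundle B) = ∑ i ∈ B, c (unitBundle {i}) := by
  rw [hc]
  simp [unitBundle, ite_mul]

open Classical in
/-- The profit from an item of unit cost `c` with prices `p` that is offered in turn to the buyers
of a list, with values `v`. -/
noncomputable def offerProfit {n : ℕ} (c : ℝ) (p v : Fin n → ℝ) : List (Fin n) → ℝ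
  | [] => 0
  | j :: l => if p j ≤ v j then p j - c else offerProfit c p v l

/-- An additive buyer decides about each item separately, so each item goes to the first buyer in
the list who accepts its price, whatever happens to the others. -/
lemma sequentialProfit_eq_sum {m n : ℕ} {c : Bundle m → ℝ} (hc : IsAdditiveCost c)
    (p v : ItemMatrix m n) (l : List (Fin n)) (R : Finset (Fin m)) :
    sequentialProfit c p v l R = ∑ i ∈ R, offerProfit (c (unitBundle {i})) (p i) (v i) l := by
  induction l generalizing R with
  | nil => simp [sequentialProfit, offerProfit]
  | cons j l ih =>
    have hsub : demand p v j R ⊆ R := (demand_maximizes p v j R).1.1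
    rw [sequentialProfit, ih, hc.unitBundle_eq, ← Finset.sum_sub_distrib,
      ← Finset.sum_sdiff hsub, add_comm]
    congr 1
    · refine Finset.sum_congr rfl fun i hi => ?_
      have : ¬ p i j ≤ v i j := fun h => by
        simp only [demand, Finset.mem_sdiff, Finset.mem_filter] at hi
        exact hi.2 ⟨hi.1, h⟩
      rw [offerProfit, if_neg this]
    · refine Finset.sum_congr rfl fun i hi => ?_
      rw [offerProfit, if_pos (Finset.mem_filter.1 hi).2]

lemma itemPricingProfit_eq_sum {m n : ℕ} {c : Bundle m → ℝ} (hc : IsAdditiveCost c)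
    (ord : Equiv.Perm (Fin n)) : itemPricingProfit c ord = fun p v =>
      ∑ i, offerProfit (c (unitBundle {i})) (p i) (v i) ((List.finRange n).map ord) := by
  funext p v
  exact sequentialProfit_eq_sum hc p v _ _

lemma offerProfit_eq_or {n : ℕ} (c : ℝ) {p p' v : Fin n → ℝ} (l : List (Fin n))
    (h : ∀ j, p j ≤ v j ↔ p' j ≤ v j) :
    offerProfit c p v l = offerProfit c p' v l ∨
      ∃ j, offerProfit c p v l = p j - c ∧ offerProfit c p' v l = p' j - c := by
  induction l with
  | nil => exact Or.inl rfl
  | cons j l ih =>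
    by_cases hj : p j ≤ v j
    · exact Or.inr ⟨j, by rw [offerProfit, if_pos hj], by rw [offerProfit, if_pos ((h j).1 hj)]⟩
    · rw [offerProfit, if_neg hj, offerProfit, if_neg (mt (h j).2 hj)]
      exact ih

open Classical in
/-- The profit from an item of unit cost `c` that is sold by a second-price auction with reserves
`p` and highest bidder rule `w` on the bids `v`. -/
noncomputable def auctionProfit {n : ℕ} (c : ℝ) (w : (Fin n → ℝ) → Fin n) (p v : Fin n → ℝ) : ℝ :=
  ∑ j, if w v = j ∧ p j ≤ v j then secondPricePayment p v j - c else 0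

lemma secondPriceProfit_eq_sum {m n : ℕ} {c : Bundle m → ℝ} (hc : IsAdditiveCost c)
    (w : Fin m → (Fin n → ℝ) → Fin n) : secondPriceProfit c w = fun p v =>
      ∑ i, auctionProfit (c (unitBundle {i})) (w i) (p i) (v i) := by
  funext p v
  simp only [auctionProfit]
  rw [Finset.sum_comm, secondPriceProfit]
  refine Finset.sum_congr rfl fun j _ => ?_
  rw [hc.unitBundle_eq, ← Finset.sum_sub_distrib, wonItems, Finset.sum_filter]

lemma auctionProfit_eq {n : ℕ} (c : ℝ) (w : (Fin n → ℝ) → Fin n) (p v : Fin n → ℝ)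
    [Decidable (p (w v) ≤ v (w v))] :
    auctionProfit c w p v =
      if p (w v) ≤ v (w v) then secondPricePayment p v (w v) - c else 0 := by
  rw [auctionProfit, Finset.sum_eq_single (w v)]
  · simp
  · intro j _ hj
    rw [if_neg fun h => hj h.1.symm]
  · simp

/-- The lower bound `t` on the reserves serves as starting value for the maximum of the other bids.
It is absorbed by the reserve, and it covers the case of no other bidder. -/
lemma exists_secondPricePayment_eq_max {n : ℕ} (v : Fin n → ℝ) (j : Fin n) (t : ℝ) :
    ∃ s, ∀ r : Fin n → ℝ, t ≤ r j → secondPricePayment r v j = max (r j) s := by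
  classical
  refine ⟨(Finset.univ.erase j).fold max t v, fun r hr => ?_⟩
  have key : ∀ B : Finset (Fin n), B.fold max (max (r j) t) v = max (r j) (B.fold max t v) := by
    intro B
    induction B using Finset.induction_on with
    | empty => simp
    | insert a B ha ih => rw [Finset.fold_insert ha, Finset.fold_insert ha, ih, max_left_comm]
  rw [← key, max_eq_left hr, secondPricePayment]

lemma auctionProfit_eq_or {n : ℕ} (c : ℝ) (w : (Fin n → ℝ) → Fin n) {p p' v : Fin n → ℝ}
    (h : ∀ j, p j ≤ v j ↔ p' j ≤ v j) :
    auctionProfit c w p v = auctionProfit c w p' v ∨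
      ∃ j s, auctionProfit c w p v = max (p j) s - c ∧
        auctionProfit c w p' v = max (p' j) s - c := by
  classical
  rw [auctionProfit_eq, auctionProfit_eq]
  by_cases hw : p (w v) ≤ v (w v)
  · obtain ⟨s, hs⟩ := exists_secondPricePayment_eq_max v (w v) (min (p (w v)) (p' (w v)))
    exact Or.inr ⟨w v, s, by rw [if_pos hw, hs _ (min_le_left _ _)],
      by rw [if_pos ((h _).1 hw), hs _ (min_le_right _ _)]⟩
  · rw [if_neg hw, if_neg (mt (h _).2 hw)]
    exact Or.inl rfl

/-! ### Posted-price form of the item profits -/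

/-- A profit function of the prices for an item and the buyers' values is of posted-price form if
it depends on the prices only through the set of buyers who accept theirs and through the price of
one buyer, chosen according to this set. -/
def IsItemProfit {n : ℕ} (c : ℝ) (g : (Fin n → ℝ) → (Fin n → ℝ) → ℝ) : Prop :=
  ∀ p p' v, (∀ j, p j ≤ v j ↔ p' j ≤ v j) →
    g p v = g p' v ∨ ∃ j s, g p v = max (p j) s - c ∧ g p' v = max (p' j) s - c

lemma isItemProfit_offerProfit {n : ℕ} (c : ℝ) (l : List (Fin n)) :
    IsItemProfit c fun p v => offerProfit c p v l := by
  intro p p' v h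
  refine (offerProfit_eq_or c l h).imp id ?_
  rintro ⟨j, h1, h2⟩
  -- A sale at the posted price fits the form with a floor below both prices.
  exact ⟨j, min (p j) (p' j), by rwa [max_eq_left (min_le_left _ _)],
    by rwa [max_eq_left (min_le_right _ _)]⟩

lemma isItemProfit_auctionProfit {n : ℕ} (c : ℝ) (w : (Fin n → ℝ) → Fin n) :
    IsItemProfit c (auctionProfit c w) :=
  fun _ _ _ h => auctionProfit_eq_or c w h

/-- The version of `IsItemProfit` for prices that are the same for all buyers: the profit depends
on the common price only through whether some buyer accepts it and through the price itself. -/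
def IsAnonymousItemProfit {n : ℕ} (c : ℝ) (g : (Fin n → ℝ) → (Fin n → ℝ) → ℝ) : Prop :=
  ∀ v q q', ((∃ j, q ≤ v j) ↔ ∃ j, q' ≤ v j) →
    g (fun _ => q) v = g (fun _ => q') v ∨
      ∃ s, g (fun _ => q) v = max q s - c ∧ g (fun _ => q') v = max q' s - c

open Classical in
lemma offerProfit_const {n : ℕ} (c q : ℝ) (v : Fin n → ℝ) (l : List (Fin n)) :
    offerProfit c (fun _ => q) v l = if ∃ j ∈ l, q ≤ v j then q - c else 0 := by
  induction l with
  | nil => simp [offerProfit]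
  | cons j l ih =>
    by_cases hj : q ≤ v j
    · simp [offerProfit, hj]
    · simp [offerProfit, hj, ih]

lemma isAnonymousItemProfit_offerProfit {n : ℕ} (c : ℝ) (ord : Equiv.Perm (Fin n)) :
    IsAnonymousItemProfit c fun p v => offerProfit c p v ((List.finRange n).map ord) := by
  classical
  intro v q q' h
  have hmem : ∀ j, j ∈ (List.finRange n).map ord := fun j =>
    List.mem_map.2 ⟨ord.symm j, List.mem_finRange _, by simp⟩
  simp only [offerProfit_const, hmem, true_and]
  by_cases hq : ∃ j, q ≤ v j
  · rw [if_pos hq, if_pos (h.1 hq)]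
    exact Or.inr ⟨min q q', by rw [max_eq_left (min_le_left _ _)],
      by rw [max_eq_left (min_le_right _ _)]⟩
  · rw [if_neg hq, if_neg (mt h.2 hq)]
    exact Or.inl rfl

lemma isAnonymousItemProfit_auctionProfit {n : ℕ} (c : ℝ) {w : (Fin n → ℝ) → Fin n}
    (hw : ∀ (v : Fin n → ℝ) (j : Fin n), v j ≤ v (w v)) : IsAnonymousItemProfit c (auctionProfit c w) := by
  classical
  intro v q q' h
  have hmax : ∀ t, (∃ j, t ≤ v j) ↔ t ≤ v (w v) := fun t =>
    ⟨fun ⟨j, hj⟩ => hj.trans (hw v j), fun ht => ⟨_, ht⟩⟩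
  rw [hmax, hmax] at h
  rw [auctionProfit_eq, auctionProfit_eq]
  by_cases hq : q ≤ v (w v)
  · obtain ⟨s, hs⟩ := exists_secondPricePayment_eq_max v (w v) (min q q')
    exact Or.inr ⟨s, by rw [if_pos hq, hs _ (min_le_left _ _)],
      by rw [if_pos (h.1 hq), hs _ (min_le_right _ _)]⟩
  · rw [if_neg hq, if_neg (mt h.2 hq)]
    exact Or.inl rfl

lemma anonymousPrices_eq {m n : ℕ} (P : Fin m → Set ℝ) :
    anonymousPrices n P = nonAnonymousPrices fun i => (fun q _ => q) '' P i := by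
  ext p
  constructor
  · rintro ⟨q, hq, hp⟩ i
    exact ⟨q i, hq i, funext fun j => (hp i j).symm⟩
  · intro hp
    choose q hq hqp using hp
    exact ⟨q, hq, fun i j => (congrFun (hqp i) j).symm⟩

/-! ### Bounds for non-anonymous and anonymous classes -/

section ItemProfits

variable {m n N : ℕ} {D : Measure (ItemMatrix m n)} [IsProbabilityMeasure D]
  {S : Fin N → ItemMatrix m n} {g : Fin m → (Fin n → ℝ) → (Fin n → ℝ) → ℝ} {c : Fin m → ℝ}
  {M : Set (ItemMatrix m n → ℝ)}

theorem empiricalRademacher_le_of_nonAnonymous (hN : 1 ≤ N) (hn : 2 ≤ n) (hD : ItemIndependent D)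
    (hS : ∀ k, S k ∈ D.support) (hg : ∀ i, IsItemProfit (c i) (g i)) {P : Fin m → Set (Fin n → ℝ)}
    (hM : M = (fun p v => ∑ i, g i (p i) (v i)) '' nonAnonymousPrices P)
    (hU : BddAbove (absProfits M D.support)) :
    empiricalRademacher M S ≤ 204 * (maxProfit M D.support * √(n * Real.log n / N)) := by
  have hn' : (2 : ℝ) ≤ n := by exact_mod_cast hn
  have hU0 := maxProfit_nonneg M D.support
  have h := empiricalRademacher_le_of_itemwise hN (by omega : 1 ≤ n) hD hS g c P hM hU fun i =>
    ⟨fun q => q.1, fun k => S k i, fun k q q' hq => hg i q.1 q'.1 (S k i) hq⟩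
  have hlog0 : 0 ≤ Real.log n := Real.log_nonneg (by linarith)
  -- For `n ≥ 2`, `3 * n ≤ n ^ 4`. The factor `4` leaves the square root as `2`, hence `204 = 2 *
  -- 102`.
  have hlog : Real.log (3 * n) ≤ 4 * Real.log n := by
    rw [show 4 * Real.log n = Real.log ((n : ℝ) ^ 4) by rw [Real.log_pow]; norm_num]
    refine Real.log_le_log (by positivity) ?_
    have : (3 : ℝ) ≤ n ^ 3 := by nlinarith [pow_le_pow_left₀ (by norm_num) hn' 3]
    calc (3 * n : ℝ) ≤ n ^ 3 * n := by gcongr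
      _ = _ := by ring
  have hsq : √(n * Real.log (3 * n) / N) ≤ 2 * √(n * Real.log n / N) := by
    calc _ ≤ √(2 ^ 2 * (n * Real.log n / N)) := by
          refine Real.sqrt_le_sqrt ?_
          rw [mul_div_assoc']
          refine div_le_div_of_nonneg_right ?_ (by positivity)
          nlinarith
      _ = _ := by rw [Real.sqrt_mul (by positivity), Real.sqrt_sq (by norm_num)]
  calc _ ≤ 102 * (maxProfit M D.support * √(n * Real.log (3 * n) / N)) := h
    _ ≤ 102 * (maxProfit M D.support * (2 * √(n * Real.log n / N))) := by gcongr
    _ = _ := by ring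

theorem empiricalRademacher_le_of_anonymous (hN : 1 ≤ N) (hD : ItemIndependent D)
    (hS : ∀ k, S k ∈ D.support) (hg : ∀ i, IsAnonymousItemProfit (c i) (g i)) {P : Fin m → Set ℝ}
    (hM : M = (fun p v => ∑ i, g i (p i) (v i)) '' anonymousPrices n P)
    (hU : BddAbove (absProfits M D.support)) :
    empiricalRademacher M S ≤ 204 * (maxProfit M D.support * √(1 / N)) := by
  have hU0 := maxProfit_nonneg M D.support
  rw [anonymousPrices_eq] at hM
  have h := empiricalRademacher_le_of_itemwise hN le_rfl hD hS g c _ hM hU fun i =>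
    -- The only price is the common one, and its threshold is the highest value.
    ⟨fun q _ => q.2.choose, fun k _ => ⨆ j, S k i j, fun k q q' hq => ?_⟩
  · have hlog : Real.log (3 * (1 : ℕ)) ≤ 2 ^ 2 := by
      have := Real.log_le_sub_one_of_pos (show (0 : ℝ) < 3 * (1 : ℕ) by norm_num)
      norm_num at this ⊢
      linarith
    have hsq : √((1 : ℕ) * Real.log (3 * (1 : ℕ)) / N) ≤ 2 * √(1 / N) := by
      calc _ ≤ √(2 ^ 2 * (1 / N)) := by
            refine Real.sqrt_le_sqrt ?_
            rw [mul_one_div, Nat.cast_one, one_mul]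
            gcongr
            simpa using hlog
        _ = _ := by rw [Real.sqrt_mul (by positivity), Real.sqrt_sq (by norm_num)]
    calc _ ≤ 102 * (maxProfit M D.support * √((1 : ℕ) * Real.log (3 * (1 : ℕ)) / N)) := h
      _ ≤ 102 * (maxProfit M D.support * (2 * √(1 / N))) := by gcongr
      _ = _ := by ring
  -- Without buyers the supremum has the default value `0`, which could pass the threshold test;
  -- hence the nonemptiness clause.
  · have hmax : ∀ t, (∃ j, t ≤ S k i j) ↔ Nonempty (Fin n) ∧ t ≤ ⨆ j, S k i j := by
      intro t
      constructor
      · rintro ⟨j, hj⟩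
        exact ⟨⟨j⟩, hj.trans (le_ciSup (Set.finite_range _).bddAbove j)⟩
      · rintro ⟨hne, ht⟩
        obtain ⟨j, hj⟩ := exists_eq_ciSup_of_finite (f := S k i)
        exact ⟨j, hj ▸ ht⟩
    have h' := hg i (S k i) q.2.choose q'.2.choose
      (by rw [hmax, hmax]; exact and_congr_right fun _ => hq 0)
    have hq1 : (fun _ => q.2.choose) = q.1 := q.2.choose_spec.2
    have hq2 : (fun _ => q'.2.choose) = q'.1 := q'.2.choose_spec.2
    rw [hq1, hq2] at h'
    exact h'.imp id fun ⟨s, hs⟩ => ⟨0, s, hs⟩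

end ItemProfits

theorem mainTheorem10 :
    ∃ C : ℝ, 0 < C ∧
      ∀ (m n N : ℕ), 1 ≤ N →
      ∀ (D : Measure (ItemMatrix m n)) [IsProbabilityMeasure D], ItemIndependent D →
      ∀ c : Bundle m → ℝ, IsAdditiveCost c →
      ∀ S : Fin N → ItemMatrix m n, (∀ k, S k ∈ D.support) →
        -- item pricing, anonymous prices
        (∀ (ord : Equiv.Perm (Fin n)) (P : Fin m → Set ℝ) (M : Set (ItemMatrix m n → ℝ)),
          M = itemPricingProfit c ord '' anonymousPrices n P →
          BddAbove (absProfits M D.support) →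
          empiricalRademacher M S ≤ C * (maxProfit M D.support * √(1 / N))) ∧
        -- item pricing, non-anonymous prices
        (2 ≤ n →
          ∀ (ord : Equiv.Perm (Fin n)) (P : Fin m → Set (Fin n → ℝ))
            (M : Set (ItemMatrix m n → ℝ)),
          M = itemPricingProfit c ord '' nonAnonymousPrices P →
          BddAbove (absProfits M D.support) →
          empiricalRademacher M S ≤ C * (maxProfit M D.support * √(n * Real.log n / N))) ∧
        -- second-price item auctions, anonymous reserves
        (∀ w : Fin m → (Fin n → ℝ) → Fin n, IsHighestBidderRule w →
          ∀ (P : Fin m → Set ℝ) (M : Set (ItemMatrix m n → ℝ)),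
          M = secondPriceProfit c w '' anonymousPrices n P →
          BddAbove (absProfits M D.support) →
          empiricalRademacher M S ≤ C * (maxProfit M D.support * √(1 / N))) ∧
        -- second-price item auctions, non-anonymous reserves
        (2 ≤ n →
          ∀ w : Fin m → (Fin n → ℝ) → Fin n, IsHighestBidderRule w →
          ∀ (P : Fin m → Set (Fin n → ℝ)) (M : Set (ItemMatrix m n → ℝ)),
          M = secondPriceProfit c w '' nonAnonymousPrices P →
          BddAbove (absProfits M D.support) →
          empiricalRademacher M S ≤ C * (maxProfit M D.support * √(n * Real.log n / N))) := by
  refine ⟨204, by norm_num, ?_⟩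
  intro m n N hN D _ hD c hc S hS
  refine ⟨?_, ?_, ?_, ?_⟩
  · intro ord P M hM hU
    rw [itemPricingProfit_eq_sum hc] at hM
    exact empiricalRademacher_le_of_anonymous hN hD hS
      (fun i => isAnonymousItemProfit_offerProfit _ ord) hM hU
  · intro hn ord P M hM hU
    rw [itemPricingProfit_eq_sum hc] at hM
    exact empiricalRademacher_le_of_nonAnonymous hN hn hD hS
      (fun i => isItemProfit_offerProfit _ _) hM hU
  · intro w hw P M hM hU
    rw [secondPriceProfit_eq_sum hc] at hM
    exact empiricalRademacher_le_of_anonymous hN hD hS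
      (fun i => isAnonymousItemProfit_auctionProfit _ (hw i)) hM hU
  · intro hn w hw P M hM hU
    rw [secondPriceProfit_eq_sum hc] at hM
    exact empiricalRademacher_le_of_nonAnonymous hN hn hD hS
      (fun i => isItemProfit_auctionProfit _ _) hM hU
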